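/- Let $\mathcal{C}$ be an abelian category, let $\xi$ be the class of all short exact sequences in $\mathcal{C}$, and let $\mathcal{W}$ be a full additive subcategory of $\mathcal{C}$ (that is, containing the zero objects and closed under finite direct sums) which is closed under isomorphisms. For any full subcategory $\mathcal{V}$ of $\mathcal{C}$, a complete $\mathcal{V}(\xi)$-resolution of an object $A$ is a complex $\cdots\to X_1\xrightarrow{d_1}X_0\xrightarrow{d_0}X_{-1}\to\cdots$ with all $X_n$ in $\mathcal{V}$, together with short exact sequences $0\to K_{n+1}\xrightarrow{g_n}X_n\xrightarrow{f_n}K_n\to0$ $(n\in\mathbb{Z})$ such that $d_{n+1}=g_nf_{n+1}$ for all $n$, such that each of these short exact sequences stays short exact under $\mathrm{Hom}_{\mathcal{C}}(V,-)$ and under $\mathrm{Hom}_{\mathcal{C}}(-,V)$ for every $V\in\mathcal{V}$, and such that $K_0\cong A$. Let $\mathcal{GV}(\xi)$ be the full subcategory of all objects of $\mathcal{C}$ that admit a complete $\mathcal{V}(\xi)$-resolution (the Gorenstein category of $\mathcal{V}$ in the sense of Sather-Wagstaff, Sharif and White). Put $\mathcal{GW}^1(\xi)=\mathcal{GW}(\xi)$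 and $\mathcal{GW}^{n+1}(\xi)=\mathcal{G}(\mathcal{GW}^n(\xi))$ for $n\ge1$, where $\mathcal{G}(\mathcal{V})=\mathcal{GV}(\xi)$. Then $\mathcal{GW}^n(\xi)=\mathcal{GW}(\xi)$ for every $n\ge1$, and $\mathcal{GW}(\xi)$ is closed under direct summands: if $G\in\mathcal{GW}(\xi)$ and $G\cong H\oplus H'$ in $\mathcal{C}$, then $H\in\mathcal{GW}(\xi)$. -/

import Mathlib

open CategoryTheory CategoryTheory.Limits

universe v u

namespace Gorenstein

section

variable {C : Type u} [Category.{v} C] [Abelian C]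

/-- The short complex `A ⟶ B ⟶ D` is `Hom(W, -)`-exact: for every `V` in `W` the sequence
`0 → Hom(V, A) → Hom(V, B) → Hom(V, D) → 0` of abelian groups is exact. -/
def IsHomExactFrom (W : ObjectProperty C) (S : ShortComplex C) : Prop :=
  ∀ V : C, W V → (S.map (preadditiveCoyoneda.obj (Opposite.op V))).ShortExact

/-- The short complex `A ⟶ B ⟶ D` is `Hom(-, W)`-exact: for every `V` in `W` the sequence
`0 → Hom(D, V) → Hom(B, V) → Hom(A, V) → 0` of abelian groups is exact. -/
def IsHomExactTo (W : ObjectProperty C) (S : ShortComplex C) : Prop :=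
  ∀ V : C, W V → (S.op.map (preadditiveYoneda.obj V)).ShortExact

/-- A decomposition of the chain complex `X` exhibiting it as a `ξ`-exact complex: sequences
`K (n + 1) ⟶ X n ⟶ K n` in `ξ`, for all integers `n`, such that each differential is the
composite `X (n + 1) ⟶ K (n + 1) ⟶ X n`. -/
structure ExactDecomposition (ξ : ObjectProperty (ShortComplex C)) (X : ChainComplex C ℤ) where
  K : ℤ → C
  g : ∀ n : ℤ, K (n + 1) ⟶ X.X n
  f : ∀ n : ℤ, X.X n ⟶ K n
  zero : ∀ n : ℤ, g n ≫ f n = 0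
  mem : ∀ n : ℤ, ξ (ShortComplex.mk (g n) (f n) (zero n))
  fac : ∀ n : ℤ, X.d (n + 1) n = f (n + 1) ≫ g n

/-- The `n`-th sequence `K (n + 1) ⟶ X n ⟶ K n` of a decomposition. -/
def ExactDecomposition.seq {ξ : ObjectProperty (ShortComplex C)} {X : ChainComplex C ℤ}
    (D : ExactDecomposition ξ X) (n : ℤ) : ShortComplex C :=
  ShortComplex.mk (D.g n) (D.f n) (D.zero n)

/-- A complete `W(ξ)`-resolution of `A`: a `ξ`-exact complex with all terms in `W`, which is both
`Hom(W, -)`-exact and `Hom(-, W)`-exact, and in which `A` is the object `K 0` occurring in the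
two sequences `K 1 ⟶ X 0 ⟶ A` and `A ⟶ X (-1) ⟶ K (-1)`. -/
structure CompleteResolution (ξ : ObjectProperty (ShortComplex C)) (W : ObjectProperty C)
    (A : C) where
  X : ChainComplex C ℤ
  mem : ∀ n : ℤ, W (X.X n)
  dec : ExactDecomposition ξ X
  exactFrom : ∀ n : ℤ, IsHomExactFrom W (dec.seq n)
  exactTo : ∀ n : ℤ, IsHomExactTo W (dec.seq n)
  iso : dec.K 0 ≅ A

/-- The Gorenstein subcategory of `W` relative to `ξ`: the objects admitting a complete
`W(ξ)`-resolution. -/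
def gorenstein (ξ : ObjectProperty (ShortComplex C)) (W : ObjectProperty C) : ObjectProperty C :=
  fun A => Nonempty (CompleteResolution ξ W A)

/-- The iterated Gorenstein subcategories: the value at `1` is `gorenstein ξ W`, and the value at
`n + 1` is the Gorenstein subcategory of the value at `n`. -/
def gorensteinPow (ξ : ObjectProperty (ShortComplex C)) (W : ObjectProperty C) :
    ℕ → ObjectProperty C
  | 0 => W
  | n + 1 => gorenstein ξ (gorensteinPow ξ W n)

/-- The class of all short exact sequences of `C`. -/
def shortExactSequences (C : Type u) [Category.{v} C] [Abelian C] :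
    ObjectProperty (ShortComplex C) :=
  fun S => S.ShortExact

end

end Gorenstein

/-!
The stability and the summand statement both follow from one observation. Call a short exact
sequence *biproper* if it is `Hom(W, -)`- and `Hom(-, W)`-exact (`IsBiproper`). Relative to the
biproper sequences every object of `W` is at once projective and injective, and an object lies in
the Gorenstein category of `W` as soon as it belongs to some class of objects in which every `A`
has biproper sequences `B ⟶ X ⟶ A` and `A ⟶ X' ⟶ B'` with `X`, `X'` in `W` and `B`, `B'` again in
the class (`gorenstein_of_forall_exists_isSyzygy`).

For an object `A` of the second Gorenstein category there are biproper sequences `A ⟶ G ⟶ K` and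
`G ⟶ X ⟶ G'` with `X` in `W`, the object `G'` in the first Gorenstein category and `K` in the
second. Then `A ⟶ X` is again the start of a biproper sequence, whose cokernel is an extension of
`G'` by `K`. The class to use is therefore the closure of the second Gorenstein category under
biproper extensions (`ExtensionClosure`): extensions are handled by the horseshoe lemma, which is
available because the objects of `W` are relatively projective and injective. Both constructions
are instances of a `3 × 3` lemma for biproper sequences (`IsBiproper.three_by_three`). The
hypotheses are self-dual, so the sequences ending in `A` are obtained in the opposite category.

Finally, if `H ⊞ H'` lies in the Gorenstein category, the split sequences
`H' ⟶ H ⊞ H' ⟶ H` and `H ⟶ H ⊞ H' ⟶ H'` alternate to give a complete resolution of `H` by objects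
of the Gorenstein category, and stability applies.
-/

namespace Gorenstein

open Opposite ZeroObject

/-! ### Biproper short exact sequences -/

section Biproper

variable {C : Type u} [Category.{v} C] [Abelian C]

/-- A short exact sequence with respect to which every object of `V` is both relatively projective
and relatively injective. -/
structure IsBiproper (V : ObjectProperty C) (S : ShortComplex C) : Prop where
  shortExact : S.ShortExact
  exists_lift : ∀ {Y : C}, V Y → ∀ h : Y ⟶ S.X₃, ∃ l : Y ⟶ S.X₂, l ≫ S.g = h
  exists_extension : ∀ {Y : C}, V Y → ∀ h : S.X₁ ⟶ Y, ∃ l : S.X₂ ⟶ Y, S.f ≫ l = h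

lemma isBiproper_iff (V : ObjectProperty C) (S : ShortComplex C) :
    IsBiproper V S ↔ S.ShortExact ∧ IsHomExactFrom V S ∧ IsHomExactTo V S := by
  constructor
  · intro h
    have := h.shortExact.mono_f
    have := h.shortExact.epi_g
    refine ⟨h.shortExact, fun Y hY => ShortComplex.ShortExact.mk' ?_ ?_ ?_,
      fun Y hY => ShortComplex.ShortExact.mk' ?_ ?_ ?_⟩
    · rw [ShortComplex.ab_exact_iff]
      intro (x : Y ⟶ S.X₂) (hx : x ≫ S.g = 0)
      exact ⟨h.shortExact.exact.lift x hx, h.shortExact.exact.lift_f x hx⟩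
    · rw [AddCommGrpCat.mono_iff_injective]
      intro (x : Y ⟶ S.X₁) (y : Y ⟶ S.X₁) (hxy : x ≫ S.f = y ≫ S.f)
      exact (cancel_mono S.f).1 hxy
    · rw [AddCommGrpCat.epi_iff_surjective]
      exact h.exists_lift hY
    · rw [ShortComplex.ab_exact_iff]
      intro (x : S.X₂ ⟶ Y) (hx : S.f ≫ x = 0)
      exact ⟨h.shortExact.exact.desc x hx, h.shortExact.exact.g_desc x hx⟩
    · rw [AddCommGrpCat.mono_iff_injective]
      intro (x : S.X₃ ⟶ Y) (y : S.X₃ ⟶ Y) (hxy : S.g ≫ x = S.g ≫ y)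
      exact (cancel_epi S.g).1 hxy
    · rw [AddCommGrpCat.epi_iff_surjective]
      exact h.exists_extension hY
  · rintro ⟨h₁, h₂, h₃⟩
    exact ⟨h₁, fun hY => (h₂ _ hY).ab_surjective_g, fun hY => (h₃ _ hY).ab_surjective_g⟩

namespace IsBiproper

variable {V : ObjectProperty C} {S : ShortComplex C}

lemma antitone {V' : ObjectProperty C} (hS : IsBiproper V S) (h : V' ≤ V) : IsBiproper V' S :=
  ⟨hS.shortExact, fun hY => hS.exists_lift (h _ hY), fun hY => hS.exists_extension (h _ hY)⟩

lemma op (hS : IsBiproper V S) : IsBiproper V.op S.op where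
  shortExact := hS.shortExact.op
  exists_lift hY h := by
    obtain ⟨l, hl⟩ := hS.exists_extension hY h.unop
    exact ⟨l.op, Quiver.Hom.unop_inj hl⟩
  exists_extension hY h := by
    obtain ⟨l, hl⟩ := hS.exists_lift hY h.unop
    exact ⟨l.op, Quiver.Hom.unop_inj hl⟩

lemma unop {S : ShortComplex Cᵒᵖ} (hS : IsBiproper V.op S) : IsBiproper V S.unop where
  shortExact := hS.shortExact.unop
  exists_lift {Y} hY h := by
    obtain ⟨l, hl⟩ := hS.exists_extension (Y := Opposite.op Y) hY h.op
    exact ⟨l.unop, Quiver.Hom.op_inj hl⟩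
  exists_extension {Y} hY h := by
    obtain ⟨l, hl⟩ := hS.exists_lift (Y := Opposite.op Y) hY h.op
    exact ⟨l.unop, Quiver.Hom.op_inj hl⟩

lemma of_iso {S' : ShortComplex C} (e : S ≅ S') (hS : IsBiproper V S) : IsBiproper V S' where
  shortExact := ShortComplex.shortExact_of_iso e hS.shortExact
  exists_lift hY h := by
    obtain ⟨l, hl⟩ := hS.exists_lift hY (h ≫ e.inv.τ₃)
    refine ⟨l ≫ e.hom.τ₂, ?_⟩
    rw [Category.assoc, e.hom.comm₂₃, reassoc_of% hl, ← ShortComplex.comp_τ₃, e.inv_hom_id,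
      ShortComplex.id_τ₃, Category.comp_id]
  exists_extension hY h := by
    obtain ⟨l, hl⟩ := hS.exists_extension hY (e.hom.τ₁ ≫ h)
    refine ⟨e.inv.τ₂ ≫ l, ?_⟩
    rw [← Category.assoc, ← e.inv.comm₁₂, Category.assoc, hl, ← Category.assoc,
      ← ShortComplex.comp_τ₁, e.inv_hom_id, ShortComplex.id_τ₁, Category.id_comp]

lemma of_splitting (s : S.Splitting) : IsBiproper V S where
  shortExact := s.shortExact
  exists_lift _ h := ⟨h ≫ s.s, by simp⟩
  exists_extension _ h := ⟨s.r ≫ h, by simp⟩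

/-- The `3 × 3` lemma for biproper sequences: in a map from one biproper sequence to another
whose outer components are the first maps of biproper sequences, the middle component is the first
map of a biproper sequence too, and the third terms form a biproper sequence. -/
lemma three_by_three {S T : ShortComplex C} (hS : IsBiproper V S) (hT : IsBiproper V T)
    (φ : S ⟶ T) {Q₁ Q₃ : C} (q₁ : T.X₁ ⟶ Q₁) (q₃ : T.X₃ ⟶ Q₃)
    (w₁ : φ.τ₁ ≫ q₁ = 0) (w₃ : φ.τ₃ ≫ q₃ = 0)
    (h₁ : IsBiproper V (ShortComplex.mk φ.τ₁ q₁ w₁))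
    (h₃ : IsBiproper V (ShortComplex.mk φ.τ₃ q₃ w₃)) :
    ∃ (Q₂ : C) (q₂ : T.X₂ ⟶ Q₂) (w₂ : φ.τ₂ ≫ q₂ = 0) (a : Q₁ ⟶ Q₂) (b : Q₂ ⟶ Q₃)
      (w : a ≫ b = 0), IsBiproper V (ShortComplex.mk φ.τ₂ q₂ w₂) ∧
        IsBiproper V (ShortComplex.mk a b w) := by
  have := hS.shortExact.mono_f
  have := hS.shortExact.epi_g
  have := hT.shortExact.mono_f
  have := hT.shortExact.epi_g
  have : Mono φ.τ₁ := h₁.shortExact.mono_f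
  have : Epi q₁ := h₁.shortExact.epi_g
  have : Mono φ.τ₃ := h₃.shortExact.mono_f
  have : Epi q₃ := h₃.shortExact.epi_g
  have : Mono φ.τ₂ := ShortComplex.mono_τ₂_of_exact_of_mono φ hS.shortExact.exact
  let p := cokernel.π φ.τ₂
  have hp : φ.τ₂ ≫ p = 0 := cokernel.condition _
  have hmid : (ShortComplex.mk φ.τ₂ p hp).Exact := ShortComplex.exact_cokernel φ.τ₂
  obtain ⟨a, ha⟩ : ∃ a : Q₁ ⟶ cokernel φ.τ₂, q₁ ≫ a = T.f ≫ p :=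
    ⟨h₁.shortExact.exact.desc (T.f ≫ p) (by
      change φ.τ₁ ≫ T.f ≫ p = 0
      rw [φ.comm₁₂_assoc, hp, comp_zero]), h₁.shortExact.exact.g_desc _ _⟩
  obtain ⟨b, hb⟩ : ∃ b : cokernel φ.τ₂ ⟶ Q₃, p ≫ b = T.g ≫ q₃ :=
    ⟨hmid.desc (T.g ≫ q₃) (by
      change φ.τ₂ ≫ T.g ≫ q₃ = 0
      rw [φ.comm₂₃_assoc, w₃, comp_zero]), hmid.g_desc _ _⟩
  have hab : a ≫ b = 0 := by
    rw [← cancel_epi q₁, reassoc_of% ha, hb, T.zero_assoc, zero_comp, comp_zero]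
  have : Epi b := by
    have : Epi (p ≫ b) := by rw [hb]; infer_instance
    exact epi_of_epi p b
  -- A generalized element of the kernel of `a` lifts to `T.X₁`, and there comes from `S.X₁`.
  have : Mono a := by
    refine Preadditive.mono_of_cancel_zero _ fun {Z} x hx => ?_
    obtain ⟨Z', π, _, y, hy⟩ := surjective_up_to_refinements_of_epi q₁ x
    have hz : (y ≫ T.f) ≫ p = 0 := by
      rw [Category.assoc, ← ha, ← reassoc_of% hy, hx, comp_zero]
    obtain ⟨z, hz'⟩ : ∃ z : Z' ⟶ S.X₂, z ≫ φ.τ₂ = y ≫ T.f :=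
      ⟨hmid.lift _ hz, hmid.lift_f _ hz⟩
    have hzg : z ≫ S.g = 0 := by
      rw [← cancel_mono φ.τ₃, Category.assoc, ← φ.comm₂₃, reassoc_of% hz', T.zero, comp_zero,
        zero_comp]
    obtain ⟨t, ht⟩ : ∃ t : Z' ⟶ S.X₁, t ≫ S.f = z :=
      ⟨hS.shortExact.exact.lift _ hzg, hS.shortExact.exact.lift_f _ hzg⟩
    have hty : t ≫ φ.τ₁ = y := by
      rw [← cancel_mono T.f, Category.assoc, φ.comm₁₂, reassoc_of% ht, hz']
    rw [← cancel_epi π, hy, ← hty, Category.assoc, w₁, comp_zero, comp_zero]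
  have hrow : (ShortComplex.mk a b hab).Exact := by
    rw [ShortComplex.exact_iff_exact_up_to_refinements]
    intro Z (x : Z ⟶ cokernel φ.τ₂) (hx : x ≫ b = 0)
    obtain ⟨Z₁, π₁, _, y, hy⟩ := surjective_up_to_refinements_of_epi p x
    have hyg : (y ≫ T.g) ≫ q₃ = 0 := by
      rw [Category.assoc, ← hb, ← reassoc_of% hy, hx, comp_zero]
    obtain ⟨c, hc⟩ : ∃ c : Z₁ ⟶ S.X₃, c ≫ φ.τ₃ = y ≫ T.g :=
      ⟨h₃.shortExact.exact.lift _ hyg, h₃.shortExact.exact.lift_f _ hyg⟩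
    obtain ⟨Z₂, π₂, _, d, hd⟩ := surjective_up_to_refinements_of_epi S.g c
    have hyd : (π₂ ≫ y - d ≫ φ.τ₂) ≫ T.g = 0 := by
      rw [Preadditive.sub_comp, Category.assoc, Category.assoc, φ.comm₂₃, ← hc,
        reassoc_of% hd, sub_self]
    obtain ⟨t, ht⟩ : ∃ t : Z₂ ⟶ T.X₁, t ≫ T.f = π₂ ≫ y - d ≫ φ.τ₂ :=
      ⟨hT.shortExact.exact.lift _ hyd, hT.shortExact.exact.lift_f _ hyd⟩
    refine ⟨Z₂, π₂ ≫ π₁, inferInstance, t ≫ q₁, ?_⟩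
    change (π₂ ≫ π₁) ≫ x = (t ≫ q₁) ≫ a
    rw [Category.assoc, hy, Category.assoc, ha, reassoc_of% ht, Preadditive.sub_comp,
      Category.assoc, Category.assoc, hp, comp_zero, sub_zero]
  refine ⟨cokernel φ.τ₂, p, hp, a, b, hab,
    ⟨ShortComplex.ShortExact.mk' hmid ‹_› (inferInstanceAs (Epi (cokernel.π _))), ?_, ?_⟩,
    ⟨ShortComplex.ShortExact.mk' hrow ‹_› ‹_›, ?_, ?_⟩⟩
  -- For the middle column, the first lift or extension is correct up to a morphism that comes from
  -- an outer column, which is lifted or extended in turn.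
  · intro Y hY (h : Y ⟶ cokernel φ.τ₂)
    obtain ⟨k, hk : k ≫ q₃ = h ≫ b⟩ := h₃.exists_lift hY (h ≫ b)
    obtain ⟨l, hl⟩ := hT.exists_lift hY k
    have hd : (h - l ≫ p) ≫ b = 0 := by
      rw [Preadditive.sub_comp, Category.assoc, hb, reassoc_of% hl, hk, sub_self]
    obtain ⟨m, hm : m ≫ q₁ = _⟩ := h₁.exists_lift hY (hrow.lift _ hd)
    have hm' : m ≫ T.f ≫ p = h - l ≫ p := by
      rw [← ha, reassoc_of% hm]
      exact hrow.lift_f _ hd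
    exact ⟨l + m ≫ T.f, by simp [hm']⟩
  · intro Y hY (h : S.X₂ ⟶ Y)
    obtain ⟨k, hk : φ.τ₁ ≫ k = S.f ≫ h⟩ := h₁.exists_extension hY (S.f ≫ h)
    obtain ⟨l, hl⟩ := hT.exists_extension hY k
    have hd : S.f ≫ (h - φ.τ₂ ≫ l) = 0 := by
      rw [Preadditive.comp_sub, ← φ.comm₁₂_assoc, hl, hk, sub_self]
    obtain ⟨m, hm : φ.τ₃ ≫ m = _⟩ := h₃.exists_extension hY (hS.shortExact.exact.desc _ hd)
    have hm' : φ.τ₂ ≫ T.g ≫ m = h - φ.τ₂ ≫ l := by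
      rw [φ.comm₂₃_assoc, hm]
      exact hS.shortExact.exact.g_desc _ hd
    exact ⟨l + T.g ≫ m, by simp [hm']⟩
  · intro Y hY (h : Y ⟶ Q₃)
    obtain ⟨k, hk : k ≫ q₃ = h⟩ := h₃.exists_lift hY h
    obtain ⟨l, hl⟩ := hT.exists_lift hY k
    exact ⟨l ≫ p, by simp [hb, reassoc_of% hl, hk]⟩
  · intro Y hY (h : Q₁ ⟶ Y)
    obtain ⟨k, hk⟩ := hT.exists_extension hY (q₁ ≫ h)
    have hd : S.f ≫ φ.τ₂ ≫ k = 0 := by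
      rw [← φ.comm₁₂_assoc, hk, reassoc_of% w₁, zero_comp]
    obtain ⟨m, hm : φ.τ₃ ≫ m = _⟩ := h₃.exists_extension hY (hS.shortExact.exact.desc _ hd)
    have hm' : φ.τ₂ ≫ (k - T.g ≫ m) = 0 := by
      rw [Preadditive.comp_sub, φ.comm₂₃_assoc, hm, sub_eq_zero]
      exact (hS.shortExact.exact.g_desc _ hd).symm
    have hn : p ≫ hmid.desc _ hm' = k - T.g ≫ m := hmid.g_desc _ hm'
    refine ⟨hmid.desc _ hm', ?_⟩
    change a ≫ hmid.desc _ hm' = h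
    rw [← cancel_epi q₁, reassoc_of% ha, hn, Preadditive.comp_sub, T.zero_assoc, zero_comp,
      sub_zero, hk]

end IsBiproper

/-! ### Extension closures and cosyzygies -/

/-- The closure of `T` under extensions by biproper sequences. -/
inductive ExtensionClosure (V T : ObjectProperty C) : ObjectProperty C
  | of {A : C} (h : T A) : ExtensionClosure V T A
  | extension {S : ShortComplex C} (hS : IsBiproper V S) (h₁ : ExtensionClosure V T S.X₁)
      (h₃ : ExtensionClosure V T S.X₃) : ExtensionClosure V T S.X₂

lemma ExtensionClosure.op {V T : ObjectProperty C} {A : C} (h : ExtensionClosure V T A) :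
    ExtensionClosure V.op T.op (op A) := by
  induction h with
  | of h => exact .of h
  | extension hS _ _ ih₁ ih₃ => exact .extension hS.op ih₃ ih₁

lemma ExtensionClosure.unop {V T : ObjectProperty C} {A : Cᵒᵖ}
    (h : ExtensionClosure V.op T.op A) : ExtensionClosure V T A.unop := by
  induction h with
  | of h => exact .of h
  | extension hS _ _ ih₁ ih₃ => exact .extension hS.unop ih₃ ih₁

/-- `IsSyzygy V U A B` means that there is a `V`-biproper sequence `B ⟶ X ⟶ A` with `X` in `U`. -/
def IsSyzygy (V U : ObjectProperty C) (A B : C) : Prop :=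
  ∃ (X : C) (g : B ⟶ X) (f : X ⟶ A) (w : g ≫ f = 0),
    U X ∧ IsBiproper V (ShortComplex.mk g f w)

lemma IsSyzygy.op {V U : ObjectProperty C} {A B : C} (h : IsSyzygy V U A B) :
    IsSyzygy V.op U.op (op B) (op A) := by
  obtain ⟨X, g, f, w, hX, h⟩ := h
  exact ⟨Opposite.op X, f.op, g.op, _, hX, h.op⟩

lemma IsSyzygy.unop {V U : ObjectProperty C} {A B : Cᵒᵖ} (h : IsSyzygy V.op U.op A B) :
    IsSyzygy V U B.unop A.unop := by
  obtain ⟨X, g, f, w, hX, h⟩ := h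
  exact ⟨X.unop, f.unop, g.unop, _, hX, h.unop⟩

lemma IsSyzygy.of_iso {V U : ObjectProperty C} {A A' B B' : C} (h : IsSyzygy V U A B)
    (e : A ≅ A') (e' : B ≅ B') : IsSyzygy V U A' B' := by
  obtain ⟨X, g, f, w, hX, h⟩ := h
  refine ⟨X, e'.inv ≫ g, f ≫ e.hom, by simp [reassoc_of% w], hX, h.of_iso ?_⟩
  exact ShortComplex.isoMk e' (Iso.refl _) e (by simp) (by simp)

lemma isBiproper_id (V : ObjectProperty C) (A : C) :
    IsBiproper V (ShortComplex.mk (𝟙 A) (0 : A ⟶ (0 : C)) comp_zero) :=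
  .of_splitting (.ofIsIsoOfIsZero _ (inferInstanceAs (IsIso (𝟙 A))) (isZero_zero C))

lemma isBiproper_zero_id (V : ObjectProperty C) (A : C) :
    IsBiproper V (ShortComplex.mk (0 : (0 : C) ⟶ A) (𝟙 A) zero_comp) :=
  .of_splitting (.ofIsZeroOfIsIso _ (isZero_zero C) (inferInstanceAs (IsIso (𝟙 A))))

/-- The horseshoe lemma, and the composition of biproper monomorphisms: if every object `A` of `T`
admits biproper sequences `A ⟶ G ⟶ K` and `G ⟶ X ⟶ G'` with `X` in `V` and `K`, `G'` in `T`, then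
every object of the extension closure of `T` has a cosyzygy in this closure. The closure condition
on `V` refers to split sequences rather than to chosen biproducts in order to be self-dual. -/
lemma ExtensionClosure.exists_cosyzygy {V U T : ObjectProperty C}
    (hV : ∀ {S : ShortComplex C}, S.Splitting → V S.X₁ → V S.X₃ → V S.X₂)
    (hT : ∀ A, T A → ∃ K, T K ∧ IsSyzygy V U K A)
    (hU : ∀ G, U G → ∃ G', T G' ∧ IsSyzygy V V G' G)
    {A : C} (hA : ExtensionClosure V T A) :
    ∃ B, ExtensionClosure V T B ∧ IsSyzygy V V B A := by
  induction hA with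
  | @of A h =>
    obtain ⟨K, hK, G, i, r, w, hG, h₁⟩ := hT A h
    obtain ⟨G', hG', X, j, q, w', hX, h₂⟩ := hU G hG
    -- The `3 × 3` lemma for the map from `A ⟶ A ⟶ 0` to `G ⟶ X ⟶ G'` with components `i`, `i ≫ j`
    -- and `0`.
    obtain ⟨Q, p, wp, a, b, wab, hcol, hrow⟩ := (isBiproper_id V A).three_by_three h₂
      { τ₁ := i, τ₂ := i ≫ j, τ₃ := (0 : (0 : C) ⟶ G') } r (𝟙 G') w zero_comp h₁
      (isBiproper_zero_id V G')
    exact ⟨Q, .extension hrow (.of hK) (.of hG'), X, i ≫ j, p, wp, hX, hcol⟩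
  | @extension S hS _ _ ih₁ ih₃ =>
    obtain ⟨A', hA', X, i, p, w, hX, h₁⟩ := ih₁
    obtain ⟨B', hB', Y, j, q, w', hY, h₃⟩ := ih₃
    obtain ⟨k, hk⟩ := hS.exists_extension hX i
    -- Relative injectivity of `X` extends `i` to `k : S.X₂ ⟶ X`; together with `S.g ≫ j` it gives
    -- a map from `S` to the split sequence `X ⟶ X ⊞ Y ⟶ Y`.
    let s := ShortComplex.Splitting.ofHasBinaryBiproduct X Y
    obtain ⟨Q, c, wc, a, b, wab, hcol, hrow⟩ := hS.three_by_three (.of_splitting s)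
      { τ₁ := i, τ₂ := biprod.lift k (S.g ≫ j), τ₃ := j
        comm₁₂ := by apply biprod.hom_ext <;> simp [hk] } p q w w' h₁ h₃
    exact ⟨Q, .extension hrow hA' hB', X ⊞ Y, _, c, wc, hV s hX hY, hcol⟩

/-- The dual of `ExtensionClosure.exists_cosyzygy`, obtained in the opposite category. -/
lemma ExtensionClosure.exists_syzygy {V U T : ObjectProperty C}
    (hV : ∀ {S : ShortComplex C}, S.Splitting → V S.X₁ → V S.X₃ → V S.X₂)
    (hT : ∀ A, T A → ∃ K, T K ∧ IsSyzygy V U A K)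
    (hU : ∀ G, U G → ∃ G', T G' ∧ IsSyzygy V V G G')
    {A : C} (hA : ExtensionClosure V T A) :
    ∃ B, ExtensionClosure V T B ∧ IsSyzygy V V A B := by
  obtain ⟨B, hB, h⟩ := hA.op.exists_cosyzygy (U := U.op)
    (fun s h₁ h₃ => hV s.unop h₃ h₁)
    (fun A hA =>
      let ⟨K, hK, h⟩ := hT A.unop hA
      ⟨Opposite.op K, hK, h.op⟩)
    (fun G hG =>
      let ⟨G', hG', h⟩ := hU G.unop hG
      ⟨Opposite.op G', hG', h.op⟩)
  exact ⟨B.unop, hB.unop, h.unop⟩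

end Biproper

/-! ### Gorenstein categories through chains of syzygies -/

/-- A relation that is total in both directions has a two-sided infinite chain through any given
element. -/
lemma exists_int_chain {α : Type*} {P : α → Prop} {R : α → α → Prop}
    (hr : ∀ a, P a → ∃ b, P b ∧ R a b) (hl : ∀ a, P a → ∃ b, P b ∧ R b a) {a : α} (ha : P a) :
    ∃ κ : ℤ → α, κ 0 = a ∧ ∀ n, R (κ n) (κ (n + 1)) := by
  have hr' : ∀ a : Subtype P, ∃ b : Subtype P, R a b := fun a =>
    let ⟨b, hb, h⟩ := hr a a.2
    ⟨⟨b, hb⟩, h⟩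
  have hl' : ∀ a : Subtype P, ∃ b : Subtype P, R b a := fun a =>
    let ⟨b, hb, h⟩ := hl a a.2
    ⟨⟨b, hb⟩, h⟩
  choose r hr' using hr'
  choose l hl' using hl'
  let κ : ℤ → Subtype P
    | .ofNat n => r^[n] ⟨a, ha⟩
    | .negSucc n => l^[n + 1] ⟨a, ha⟩
  refine ⟨fun n => κ n, rfl, fun n => ?_⟩
  match n with
  | .ofNat n =>
    change R (r^[n] ⟨a, ha⟩ : Subtype P) (r^[n + 1] ⟨a, ha⟩ : Subtype P)
    rw [Function.iterate_succ_apply']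
    exact hr' _
  | .negSucc 0 => exact hl' _
  | .negSucc (n + 1) =>
    change R (l^[n + 2] ⟨a, ha⟩ : Subtype P) (l^[n + 1] ⟨a, ha⟩ : Subtype P)
    rw [Function.iterate_succ_apply' l (n + 1)]
    exact hl' _

section

variable {C : Type u} [Category.{v} C] [Abelian C]

lemma gorenstein_iff (V : ObjectProperty C) (A : C) :
    gorenstein (shortExactSequences C) V A ↔
      ∃ κ : ℤ → C, Nonempty (κ 0 ≅ A) ∧ ∀ n, IsSyzygy V V (κ n) (κ (n + 1)) := by
  constructor
  · rintro ⟨R⟩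
    exact ⟨R.dec.K, ⟨R.iso⟩, fun n => ⟨R.X.X n, R.dec.g n, R.dec.f n, R.dec.zero n, R.mem n,
      (isBiproper_iff _ _).2 ⟨R.dec.mem n, R.exactFrom n, R.exactTo n⟩⟩⟩
  · rintro ⟨κ, ⟨e⟩, h⟩
    choose X g f w hX h using h
    refine ⟨{
      X := ChainComplex.of X (fun n => f (n + 1) ≫ g n) fun n => by
        rw [Category.assoc, reassoc_of% (w (n + 1)), zero_comp, comp_zero]
      mem := hX
      dec := ⟨κ, g, f, w, fun n => (h n).shortExact, fun n =>
        ChainComplex.of_d X (fun n => f (n + 1) ≫ g n) n⟩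
      exactFrom := fun n => ((isBiproper_iff _ _).1 (h n)).2.1
      exactTo := fun n => ((isBiproper_iff _ _).1 (h n)).2.2
      iso := e }⟩

lemma gorenstein_of_iso {V : ObjectProperty C} {A B : C} (e : A ≅ B)
    (h : gorenstein (shortExactSequences C) V A) : gorenstein (shortExactSequences C) V B :=
  h.map fun R => { R with iso := R.iso ≪≫ e }

/-- The Gorenstein category of `V` contains every class of objects that is closed under taking
some syzygy and some cosyzygy of each of its objects. -/
lemma gorenstein_of_forall_exists_isSyzygy {V P : ObjectProperty C}
    (hl : ∀ A, P A → ∃ B, P B ∧ IsSyzygy V V A B) (hr : ∀ A, P A → ∃ B, P B ∧ IsSyzygy V V B A) :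
    P ≤ gorenstein (shortExactSequences C) V := fun A hA => by
  obtain ⟨κ, rfl, h⟩ := exists_int_chain hl hr hA
  exact (gorenstein_iff _ _).2 ⟨κ, ⟨Iso.refl _⟩, h⟩

lemma exists_syzygy_of_gorenstein {V : ObjectProperty C} {A : C}
    (h : gorenstein (shortExactSequences C) V A) :
    ∃ B, gorenstein (shortExactSequences C) V B ∧ IsSyzygy V V A B := by
  obtain ⟨κ, ⟨e⟩, h⟩ := (gorenstein_iff _ _).1 h
  refine ⟨κ 1, (gorenstein_iff _ _).2 ⟨fun n => κ (n + 1), ⟨Iso.refl _⟩, fun n => h _⟩, ?_⟩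
  exact (h 0).of_iso e (Iso.refl _)

lemma exists_cosyzygy_of_gorenstein {V : ObjectProperty C} {A : C}
    (h : gorenstein (shortExactSequences C) V A) :
    ∃ B, gorenstein (shortExactSequences C) V B ∧ IsSyzygy V V B A := by
  obtain ⟨κ, ⟨e⟩, h⟩ := (gorenstein_iff _ _).1 h
  refine ⟨κ (-1), (gorenstein_iff _ _).2 ⟨fun n => κ (n - 1), ⟨Iso.refl _⟩, fun n => ?_⟩, ?_⟩
  · have := h (n - 1)
    rwa [show n - 1 + 1 = n + 1 - 1 by ring] at this
  · exact (h (-1)).of_iso (Iso.refl _) e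

lemma IsSyzygy.antitone {V V' U : ObjectProperty C} {A B : C} (h : IsSyzygy V U A B)
    (hV : V' ≤ V) : IsSyzygy V' U A B := by
  obtain ⟨X, g, f, w, hX, h⟩ := h
  exact ⟨X, g, f, w, hX, h.antitone hV⟩

lemma le_gorenstein {V : ObjectProperty C} (hV : V 0) :
    V ≤ gorenstein (shortExactSequences C) V :=
  gorenstein_of_forall_exists_isSyzygy
    (fun A hA => ⟨0, hV, A, 0, 𝟙 A, zero_comp, hA, isBiproper_zero_id V A⟩)
    (fun A hA => ⟨0, hV, A, 𝟙 A, 0, comp_zero, hA, isBiproper_id V A⟩)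

/-- Stability of Gorenstein categories: the extension closure of the second Gorenstein category
is closed under taking some syzygy and some cosyzygy, with middle terms in `V`. -/
lemma gorenstein_gorenstein {V : ObjectProperty C} (hV₀ : V 0)
    (hV : ∀ {S : ShortComplex C}, S.Splitting → V S.X₁ → V S.X₃ → V S.X₂) :
    gorenstein (shortExactSequences C) (gorenstein (shortExactSequences C) V) =
      gorenstein (shortExactSequences C) V := by
  have hle := le_gorenstein hV₀
  have hle' := le_gorenstein (V := gorenstein (shortExactSequences C) V) (hle _ hV₀)
  refine le_antisymm (fun A hA => ?_) hle'
  let U := gorenstein (shortExactSequences C) V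
  let T := gorenstein (shortExactSequences C) U
  refine gorenstein_of_forall_exists_isSyzygy (P := ExtensionClosure V T)
    (fun _ h => h.exists_syzygy (U := U) hV (fun A hA => ?_) (fun G hG => ?_))
    (fun _ h => h.exists_cosyzygy (U := U) hV (fun A hA => ?_) (fun G hG => ?_)) A (.of hA)
  · exact (exists_syzygy_of_gorenstein hA).imp fun _ h => ⟨h.1, h.2.antitone hle⟩
  · exact (exists_syzygy_of_gorenstein hG).imp fun _ h => ⟨hle' _ h.1, h.2⟩
  · exact (exists_cosyzygy_of_gorenstein hA).imp fun _ h => ⟨h.1, h.2.antitone hle⟩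
  · exact (exists_cosyzygy_of_gorenstein hG).imp fun _ h => ⟨hle' _ h.1, h.2⟩

/-- A direct summand of an object of `V` lies in the Gorenstein category of `V`: the two
complementary split sequences alternate. -/
lemma gorenstein_of_biprod {V : ObjectProperty C} {H H' : C} (h : V (H ⊞ H'))
    (h' : V (H' ⊞ H)) : gorenstein (shortExactSequences C) V H := by
  have h₁ : IsSyzygy V V H H' :=
    ⟨H' ⊞ H, biprod.inl, biprod.snd, _, h', .of_splitting (.ofHasBinaryBiproduct _ _)⟩
  have h₂ : IsSyzygy V V H' H :=
    ⟨H ⊞ H', biprod.inl, biprod.snd, _, h, .of_splitting (.ofHasBinaryBiproduct _ _)⟩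
  refine gorenstein_of_forall_exists_isSyzygy (P := fun A => A = H ∨ A = H') ?_ ?_ H (.inl rfl)
  · rintro _ (rfl | rfl)
    exacts [⟨H', .inr rfl, h₁⟩, ⟨H, .inl rfl, h₂⟩]
  · rintro _ (rfl | rfl)
    exacts [⟨H', .inr rfl, h₂⟩, ⟨H, .inl rfl, h₁⟩]

end

end Gorenstein

theorem mainTheorem7 {C : Type u} [Category.{v} C] [Abelian C] (W : ObjectProperty C)
    [W.IsClosedUnderIsomorphisms] (hzero : ∀ Z : C, IsZero Z → W Z)
    (hsum : ∀ A B : C, W A → W B → W (A ⊞ B)) :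
    (∀ n : ℕ, 1 ≤ n →
      Gorenstein.gorensteinPow (Gorenstein.shortExactSequences C) W n =
        Gorenstein.gorenstein (Gorenstein.shortExactSequences C) W) ∧
    (∀ G H H' : C, Gorenstein.gorenstein (Gorenstein.shortExactSequences C) W G →
      Nonempty (G ≅ H ⊞ H') →
      Gorenstein.gorenstein (Gorenstein.shortExactSequences C) W H) := by
  have hV {S : ShortComplex C} (s : S.Splitting) (h₁ : W S.X₁) (h₃ : W S.X₃) : W S.X₂ :=
    W.prop_of_iso s.isoBinaryBiproduct.symm (hsum _ _ h₁ h₃)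
  have hstable := Gorenstein.gorenstein_gorenstein (hzero _ (isZero_zero C)) hV
  refine ⟨fun n hn => ?_, fun G H H' hG ⟨e⟩ => ?_⟩
  · induction n, hn using Nat.le_induction with
    | base => rfl
    | succ n _ ih => rw [Gorenstein.gorensteinPow, ih, hstable]
  · rw [← hstable]
    exact Gorenstein.gorenstein_of_biprod (Gorenstein.gorenstein_of_iso e hG)
      (Gorenstein.gorenstein_of_iso (e ≪≫ biprod.braiding _ _) hG)
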